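/- Let $\{n_k\}_{k\ge 1}$ be a sequence of integers $n_k\ge 2$, and let $K$ be a field that contains a primitive $n_k$-th root of unity for every $k\ge 1$. For $k\ge 1$ let $f_k=a_kx^{n_k}+b_k\in K[x]$ with $a_k\neq 0$, put $\mathcal F=\{f_k\}_{k\ge 1}$, and let $\alpha\in K$. Write $f^{(0)}=x$ and $f^{(m)}=f_1\circ\cdots\circ f_m$ for $m\ge 1$. Let $c_{1,\alpha}=\alpha-f_1(0)$ if $n_1=2$, and $c_{m,\alpha}=f^{(m)}(0)-\alpha$ in all other cases with $m\ge 1$. Let $N_m=n_1\cdots n_m$ (with $N_0=1$) and, for $m\ge 1$, $$\widetilde c_{m,\alpha}=(-1)^{N_{m-1}}\,\frac{f^{(m)}(0)-\alpha}{\prod_{i=1}^{m}a_i^{N_{i-1}}},$$ where the denominator is the leading coefficient of $f^{(m)}$. Suppose that $c_{m,\alpha}\neq 0$ for every $m\ge 1$ (equivalently, all the polynomials $f^{(m)}-\alpha$ are separable). Let $d_1$ be the degree over $K$ of the field generated by the roots of $f_1-\alpha$ in a separable closure $K^{\mathrm{sep}}$. Let $G_\infty(\mathcal F,\alpha)$ be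 the Galois group over $K$ of the subfield of $K^{\mathrm{sep}}$ generated over $K$ by all roots of all $f^{(m)}-\alpha$, $m\ge 0$, and suppose that $G_\infty(\mathcal F,\alpha)$ is abelian. Then $d_1$ divides $n_1$, there is an element $\gamma_1\in K^\times$ with $\gamma_1^{n_1/d_1}=\widetilde c_{1,\alpha}$, and for every such $\gamma_1$ the subgroup of $K^\times/K^{\times d_1}$ spanned by the classes of $$\widetilde c_{k,\alpha}^{\;d_1/\gcd(d_1,n_k)},\qquad k\ge 2,$$ is contained in the cyclic subgroup generated by the class of $\gamma_1$. -/

import Mathlib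

open Polynomial

namespace ArborealSeq

noncomputable section

variable {K : Type*} [Field K]

/-- The polynomial `f_k = a_k x^{n_k} + b_k`. Sequences are indexed from `1`; the entries of
`n`, `a`, `b` at index `0` play no role. -/
def poly (n : ℕ → ℕ) (a b : ℕ → K) (k : ℕ) : K[X] :=
  C (a k) * X ^ n k + C (b k)

/-- The composition `f^{(m)} = f_1 ∘ ⋯ ∘ f_m`, with `f^{(0)} = x`. -/
def iter (n : ℕ → ℕ) (a b : ℕ → K) : ℕ → K[X]
  | 0 => X
  | m + 1 => (iter n a b m).comp (poly n a b (m + 1))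

/-- The adjusted post-critical orbit `c_{m,α}` of the sequence `(f_k)` and the point `α`. -/
def adjOrbit (n : ℕ → ℕ) (a b : ℕ → K) (α : K) (m : ℕ) : K :=
  if n 1 = 2 ∧ m = 1 then -(poly n a b 1).eval 0 + α
  else (iter n a b m).eval 0 - α

/-- The number `#L_m = n_1 ⋯ n_m` of nodes at level `m` of the tree. -/
def levelCard (n : ℕ → ℕ) (m : ℕ) : ℕ :=
  ∏ i ∈ Finset.Icc 1 m, n i

/-- The element `c̃_{m,α} = (-1)^{#L_{m-1}} (f^{(m)}(0) - α) / ∏_{i=1}^m a_i^{#L_{i-1}}`, used for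
`m ≥ 1`. The denominator is the leading coefficient of `f^{(m)}`. -/
def cTilde (n : ℕ → ℕ) (a b : ℕ → K) (α : K) (m : ℕ) : K :=
  (-1) ^ levelCard n (m - 1) *
    (((iter n a b m).eval 0 - α) / ∏ i ∈ Finset.Icc 1 m, a i ^ levelCard n (i - 1))

theorem cTilde_ne_zero {n : ℕ → ℕ} {a b : ℕ → K} {α : K} (ha : ∀ k, 1 ≤ k → a k ≠ 0)
    (hc : ∀ m, 1 ≤ m → adjOrbit n a b α m ≠ 0) (m : ℕ) (hm : 1 ≤ m) :
    cTilde n a b α m ≠ 0 := by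
  have h1 : (iter n a b m).eval 0 - α ≠ 0 := by
    have h := hc m hm
    unfold adjOrbit at h
    split_ifs at h with h2
    · obtain ⟨-, rfl⟩ := h2
      intro h3
      apply h
      simp only [iter, X_comp] at h3
      rw [sub_eq_zero.mp h3, neg_add_cancel]
    · exact h
  unfold cTilde
  refine mul_ne_zero (pow_ne_zero _ (neg_ne_zero.mpr one_ne_zero)) (div_ne_zero h1 ?_)
  refine Finset.prod_ne_zero_iff.mpr fun i hi => pow_ne_zero _ (ha i ?_)
  exact (Finset.mem_Icc.mp hi).1

/-- `c̃_{m,α}` as an element of `Kˣ`, when `a_k ≠ 0` and `c_{k,α} ≠ 0` for all `k ≥ 1`. -/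
def cTildeUnit {n : ℕ → ℕ} {a b : ℕ → K} {α : K} (ha : ∀ k, 1 ≤ k → a k ≠ 0)
    (hc : ∀ m, 1 ≤ m → adjOrbit n a b α m ≠ 0) (m : ℕ) (hm : 1 ≤ m) : Kˣ :=
  Units.mk0 (cTilde n a b α m) (cTilde_ne_zero ha hc m hm)

/-- The extension of `K` generated by all roots of `f_1 - α` in the separable closure. -/
def firstField (n : ℕ → ℕ) (a b : ℕ → K) (α : K) : IntermediateField K (SeparableClosure K) :=
  IntermediateField.adjoin K ((poly n a b 1 - C α).rootSet (SeparableClosure K))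

/-- The arboreal field: the extension of `K` generated by all nodes of the tree, that is, by the
roots in the separable closure of all the polynomials `f^{(m)} - α`. -/
def arborealField (n : ℕ → ℕ) (a b : ℕ → K) (α : K) :
    IntermediateField K (SeparableClosure K) :=
  IntermediateField.adjoin K (⋃ m : ℕ, (iter n a b m - C α).rootSet (SeparableClosure K))

/-- The arboreal Galois group `G_∞`: the Galois group of the arboreal field over `K`. -/
abbrev arborealGroup (n : ℕ → ℕ) (a b : ℕ → K) (α : K) : Type _ :=
  arborealField n a b α ≃ₐ[K] arborealField n a b α

/-- The subgroup `K^{×d}` of `d`-th powers in `K^×`. -/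
abbrev powSubgroup (K : Type*) [Field K] (d : ℕ) : Subgroup Kˣ :=
  (powMonoidHom d : Kˣ →* Kˣ).range

end

end ArborealSeq

/-! Fix `β` with `β ^ n 1 = c̃_1`, so that the roots of `f_1 - α` are `ζ ^ j * β` and `K(β)` has
degree `d₁`. Then `c̃_k` is the product over `j` of the invariant `c̃_{k-1}` of the shifted sequence
at `ζ ^ j * β` (`cTilde_succ_eq_prod`), and each factor has an `n k`-th root `w j` that is a product
of nodes, hence lies in the arboreal field (`exists_pow_eq_cTilde`).

An automorphism `ρ` fixing `β` scales each `w j` by an `n k`-th root of unity. Some `τ` sends `β` to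
`ζ ^ (n 1 / d₁) * β`, hence `w j` to a multiple of `w (j + n 1 / d₁)`. Since `ρ` and `τ` commute on
the arboreal field, the scaling factors have period `n 1 / d₁` in `j`, so `ρ` scales `∏ w j` by a
`d₁`-th power of an `n k`-th root of unity. With `g = gcd(d₁, n k)`, the power `y = (∏ w j) ^ (n k /
g)` is therefore fixed by `ρ` (`prod_pow_fixed_of_comm`).

Thus `y` lies in `K(β)`, and `y ^ d₁ = c̃_k ^ (d₁ / g)` lies in `K`. Kummer theory gives `y = u * β
^ e` with `u` in `K` (`exists_eq_mul_pow_of_fixed`); the `d₁`-th power of this equation is the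
claim. -/

open Polynomial

namespace ArborealSeq

/-! ### Multiplicativity of `c̃` along the first level of the tree -/

section Recursion

variable {F : Type*} [Field F]

theorem iter_map {E : Type*} [Field E] (φ : F →+* E) (n : ℕ → ℕ) (a b : ℕ → F) (m : ℕ) :
    (iter n a b m).map φ = iter n (fun i => φ (a i)) (fun i => φ (b i)) m := by
  induction m with
  | zero => simp [iter]
  | succ m ih => simp [iter, Polynomial.map_comp, ih, poly]

theorem natDegree_poly {n : ℕ → ℕ} {a b : ℕ → F} {k : ℕ} (ha : a k ≠ 0) :
    (poly n a b k).natDegree = n k := by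
  rw [poly, natDegree_add_C, natDegree_C_mul_X_pow _ _ ha]

theorem natDegree_iter_pos {n : ℕ → ℕ} {a b : ℕ → F} (hn : ∀ k, 1 ≤ k → 0 < n k)
    (ha : ∀ k, 1 ≤ k → a k ≠ 0) (m : ℕ) : 0 < (iter n a b m).natDegree := by
  induction m with
  | zero => simp [iter]
  | succ m ih =>
    rw [iter, natDegree_comp, natDegree_poly (ha _ (by omega))]
    exact Nat.mul_pos ih (hn _ (by omega))

theorem iter_sub_C_ne_zero {n : ℕ → ℕ} {a b : ℕ → F} (hn : ∀ k, 1 ≤ k → 0 < n k)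
    (ha : ∀ k, 1 ≤ k → a k ≠ 0) (α : F) (m : ℕ) : iter n a b m - C α ≠ 0 := by
  intro h
  have := natDegree_iter_pos (b := b) hn ha m
  rw [sub_eq_zero.mp h, natDegree_C] at this
  omega

/-- `f_1 ∘ ⋯ ∘ f_{m+1}` is `f_1` composed with the `m`-th composition of the shifted sequence. -/
theorem iter_eval_succ (n : ℕ → ℕ) (a b : ℕ → F) (m : ℕ) (x : F) :
    (iter n a b (m + 1)).eval x =
      a 1 * (iter (fun i => n (i + 1)) (fun i => a (i + 1)) (fun i => b (i + 1)) m).eval x ^ n 1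
        + b 1 := by
  induction m generalizing x with
  | zero => simp [iter, poly]
  | succ m ih =>
    rw [iter, eval_comp, ih, iter, eval_comp]
    simp [poly]

theorem levelCard_succ (n : ℕ → ℕ) (m : ℕ) :
    levelCard n (m + 1) = n 1 * levelCard (fun i => n (i + 1)) m := by
  induction m with
  | zero => simp [levelCard]
  | succ m ih =>
    have h (k : ℕ → ℕ) (j : ℕ) : levelCard k (j + 1) = levelCard k j * k (j + 1) :=
      Finset.prod_Icc_succ_top (by omega) _
    rw [h n, ih, h, mul_assoc]

theorem leadingCoeff_prod_succ (n : ℕ → ℕ) (a : ℕ → F) (m : ℕ) :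
    ∏ i ∈ Finset.Icc 1 (m + 1), a i ^ levelCard n (i - 1) =
      a 1 * (∏ i ∈ Finset.Icc 1 m, a (i + 1) ^ levelCard (fun i => n (i + 1)) (i - 1)) ^ n 1 := by
  induction m with
  | zero => simp [levelCard]
  | succ m ih =>
    rw [Finset.prod_Icc_succ_top (by omega), ih, Finset.prod_Icc_succ_top (by omega)]
    simp only [Nat.add_sub_cancel]
    rw [levelCard_succ, mul_pow, ← pow_mul, mul_comm (n 1), mul_assoc]

/-- `c̃_{m+1}` at `α` is the product of the `c̃_m` of the shifted sequence at the roots of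
`f_1 - α`. -/
theorem cTilde_succ_eq_prod {n : ℕ → ℕ} (a b : ℕ → F) (hn : 0 < n 1) (ha : a 1 ≠ 0) {ζ β : F}
    (hζ : IsPrimitiveRoot ζ (n 1)) (m : ℕ) :
    cTilde n a b (a 1 * β ^ n 1 + b 1) (m + 2) =
      ∏ j ∈ Finset.range (n 1),
        cTilde (fun i => n (i + 1)) (fun i => a (i + 1)) (fun i => b (i + 1)) (ζ ^ j * β)
          (m + 1) := by
  -- This factorization multiplies the differences between the shifted orbit value and the points `ζ
  -- ^ j * β`. The sign and the leading coefficient match because level sizes gain a factor `n 1`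
  -- when `f_1` is put in front.
  have key (y : F) : y ^ n 1 - β ^ n 1 = ∏ j ∈ Finset.range (n 1), (y - ζ ^ j * β) := by
    have := congrArg (eval y) (X_pow_sub_C_eq_prod hζ hn (rfl : β ^ n 1 = β ^ n 1))
    simpa [eval_prod] using this
  simp only [cTilde, Finset.prod_mul_distrib, Finset.prod_div_distrib, ← key, Finset.prod_const,
    Finset.card_range, iter_eval_succ n a b (m + 1), leadingCoeff_prod_succ n a (m + 1),
    Nat.add_sub_cancel]
  rw [show m + 2 - 1 = m + 1 from rfl, levelCard_succ, add_sub_add_right_eq_sub, ← mul_sub,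
    mul_div_mul_left _ _ ha, ← pow_mul, mul_comm (n 1)]

theorem cTilde_one_eq {n : ℕ → ℕ} (a b : ℕ → F) (α : F) (hn : n 1 ≠ 0) :
    cTilde n a b α 1 = (α - b 1) / a 1 := by
  simp [cTilde, levelCard, iter, poly, hn, ← neg_div]

theorem map_cTilde {E : Type*} [Field E] (φ : F →+* E) (n : ℕ → ℕ) (a b : ℕ → F) (α : F) (m : ℕ) :
    φ (cTilde n a b α m) = cTilde n (fun i => φ (a i)) (fun i => φ (b i)) (φ α) m := by
  have h : φ ((iter n a b m).eval 0) = ((iter n a b m).map φ).eval 0 := by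
    rw [eval_map, ← eval₂_at_apply, map_zero]
  simp [cTilde, h, iter_map]

/-- Over a separably closed field `c̃_m` is an `n_m`-th power of a product of solutions of
`f^{(m)}(z) = α`. -/
theorem exists_pow_eq_cTilde [IsSepClosed F] (m : ℕ) (n : ℕ → ℕ) (a b : ℕ → F) (α : F)
    (hn : ∀ k, 1 ≤ k → 0 < n k) (hζ : ∀ k, 1 ≤ k → ∃ ζ : F, IsPrimitiveRoot ζ (n k))
    (ha : ∀ k, 1 ≤ k → a k ≠ 0) (S : Submonoid F)
    (hS : ∀ z, (iter n a b (m + 1)).eval z = α → z ∈ S) :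
    ∃ w ∈ S, w ^ n (m + 1) = cTilde n a b α (m + 1) := by
  have h1 := ha 1 le_rfl
  obtain ⟨ζ, hζ1⟩ := hζ 1 le_rfl
  have hn1 : NeZero (n 1) := ⟨(hn 1 le_rfl).ne'⟩
  have : NeZero (n 1 : F) := hζ1.neZero'
  obtain ⟨β, hβ⟩ := IsSepClosed.exists_pow_nat_eq ((α - b 1) / a 1) (n 1)
  have hα : a 1 * β ^ n 1 + b 1 = α := by rw [hβ]; field_simp; ring
  -- The induction peels off `f_1`, so the sequence and the base point vary. `S` stays fixed: a
  -- solution for the shifted sequence at `ζ ^ j * β` is a solution for the original one at `α`.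
  induction m generalizing n a b α β ζ with
  | zero =>
    refine ⟨β, hS _ ?_, ?_⟩
    · simpa [iter, poly] using hα
    · rw [hβ, cTilde_one_eq a b α (hn 1 le_rfl).ne']
  | succ m ih =>
    have hstep (j : ℕ) : ∃ w ∈ S, w ^ n (m + 2) =
        cTilde (fun i => n (i + 1)) (fun i => a (i + 1)) (fun i => b (i + 1)) (ζ ^ j * β)
          (m + 1) := by
      obtain ⟨ζ', hζ'⟩ := hζ 2 (by omega)
      have hn2 : NeZero (n 2) := ⟨(hn 2 (by omega)).ne'⟩
      have : NeZero (n 2 : F) := hζ'.neZero'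
      obtain ⟨β', hβ'⟩ := IsSepClosed.exists_pow_nat_eq ((ζ ^ j * β - b 2) / a 2) (n 2)
      have h2 := ha 2 (by omega)
      refine ih (fun i => n (i + 1)) (fun i => a (i + 1)) (fun i => b (i + 1)) _
        (fun k hk => hn _ (by omega)) (fun k hk => hζ _ (by omega)) (fun k hk => ha _ (by omega))
        (fun z hz => hS z ?_) h2 ζ' hζ' hn2 this β' hβ' ?_
      · rw [iter_eval_succ, hz, mul_pow, ← pow_mul, mul_comm j, pow_mul, hζ1.pow_eq_one, one_pow,
          one_mul, hα]
      · rw [hβ']; field_simp; ring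
    choose w hwS hw using hstep
    refine ⟨∏ j ∈ Finset.range (n 1), w j, S.prod_mem fun j _ => hwS j, ?_⟩
    rw [← Finset.prod_pow, ← hα, cTilde_succ_eq_prod a b (hn 1 le_rfl) h1 hζ1]
    exact Finset.prod_congr rfl fun j _ => hw j

end Recursion

/-! ### Degrees and conjugates of radicals -/

section Kummer

variable {K Ω : Type*} [Field K] [Field Ω] [Algebra K Ω]

theorem exists_smul_of_pow_eq {n : ℕ} [NeZero n] {ζ : K} (hζ : IsPrimitiveRoot ζ n) {x y : Ω}
    (hy : y ≠ 0) (h : x ^ n = y ^ n) : ∃ i : ℕ, x = algebraMap K Ω (ζ ^ i) * y := by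
  have hζ' := hζ.map_of_injective (algebraMap K Ω).injective
  obtain ⟨i, -, hi⟩ := hζ'.eq_pow_of_pow_eq_one
    (show (x / y) ^ n = 1 by rw [div_pow, h, div_self (pow_ne_zero _ hy)])
  exact ⟨i, by rw [map_pow, hi, div_mul_cancel₀ _ hy]⟩

/-- If `β ^ n` and the `n`-th roots of unity lie in `K`, then already `β ^ d` lies in `K`, where
`d` is the degree of `β`, and `d` divides `n`. -/
theorem exists_pow_natDegree_minpoly_eq [Normal K Ω] {n : ℕ} [NeZero n] {ζ : K}
    (hζ : IsPrimitiveRoot ζ n) {β : Ω} (hβ : β ≠ 0) {c : K} (hc : β ^ n = algebraMap K Ω c) :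
    (minpoly K β).natDegree ∣ n ∧
      ∃ γ : K, β ^ (minpoly K β).natDegree = algebraMap K Ω γ := by
  have hint : IsIntegral K β := Normal.isIntegral inferInstance β
  have hdpos := minpoly.natDegree_pos hint
  set d := (minpoly K β).natDegree with hd
  -- Every conjugate of `β` is a root of unity in `K` times `β`, so the constant term of the minimal
  -- polynomial, a signed product of conjugates, is `β ^ d` up to a factor in `K`.
  have hroot (r : Ω) (hr : r ∈ ((minpoly K β).map (algebraMap K Ω)).roots) : r ^ n = β ^ n := by
    have hdvd : minpoly K β ∣ X ^ n - C c := minpoly.dvd _ _ (by simp [hc])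
    have h0 : aeval r (minpoly K β) = 0 := by
      rw [mem_roots', IsRoot.def, eval_map_algebraMap] at hr
      exact hr.2
    have := aeval_eq_zero_of_dvd_aeval_eq_zero hdvd h0
    rw [hc]
    simpa [sub_eq_zero] using this
  have hprod (s : Multiset Ω) (hs : ∀ r ∈ s, r ^ n = β ^ n) :
      ∃ u : K, u ≠ 0 ∧ s.prod = algebraMap K Ω u * β ^ s.card := by
    induction s using Multiset.induction with
    | empty => exact ⟨1, by simp⟩
    | cons r s ih =>
      obtain ⟨u, hu, hsu⟩ := ih fun r hr => hs r (Multiset.mem_cons_of_mem hr)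
      obtain ⟨i, hi⟩ := exists_smul_of_pow_eq hζ hβ (hs r (Multiset.mem_cons_self r s))
      refine ⟨ζ ^ i * u, mul_ne_zero (pow_ne_zero _ (hζ.ne_zero (NeZero.ne n))) hu, ?_⟩
      rw [Multiset.prod_cons, hsu, Multiset.card_cons, hi, map_mul, pow_succ]
      ring
  have hsplit : ((minpoly K β).map (algebraMap K Ω)).Splits := Normal.splits inferInstance β
  have hγ : ∃ γ : K, β ^ d = algebraMap K Ω γ := by
    obtain ⟨u, hu, h⟩ := hprod _ hroot
    have hcard := hsplit.natDegree_eq_card_roots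
    rw [natDegree_map] at hcard
    have h0 := hsplit.coeff_zero_eq_prod_roots_of_monic ((minpoly.monic hint).map _)
    rw [h, natDegree_map, ← hcard, coeff_map] at h0
    have hu' : algebraMap K Ω u ≠ 0 := by simpa using hu
    refine ⟨(-1) ^ d * (minpoly K β).coeff 0 / u, ?_⟩
    rw [map_div₀, map_mul, h0, map_pow, map_neg, map_one, ← mul_assoc, ← hd, ← mul_pow]
    field_simp
    simp
  refine ⟨?_, hγ⟩
  obtain ⟨γ, hγ⟩ := hγ
  by_contra hnd
  have hr : 0 < n % d := Nat.pos_of_ne_zero fun h => hnd (Nat.dvd_of_mod_eq_zero h)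
  have hγ0 : algebraMap K Ω γ ≠ 0 := hγ ▸ pow_ne_zero _ hβ
  -- If `d` does not divide `n`, the power of `β` with exponent the remainder lies in `K`,
  -- contradicting minimality of `d`.
  have hβr : β ^ (n % d) = algebraMap K Ω (c / γ ^ (n / d)) := by
    rw [map_div₀, map_pow, ← hc, ← hγ, eq_div_iff (by simp [hβ]), ← pow_mul, ← pow_add,
      Nat.mod_add_div]
  have hle := minpoly.min K β (monic_X_pow_sub_C (c / γ ^ (n / d)) hr.ne') (by simp [hβr])
  rw [degree_X_pow_sub_C hr, degree_eq_natDegree (minpoly.ne_zero hint), ← hd] at hle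
  exact absurd (Nat.cast_le.mp hle) (not_le.mpr (Nat.mod_lt _ hdpos))

/-- If `β` has degree `d` and `β ^ d` lies in `K`, then every `d`-th root of unity in `K` comes from
an automorphism. -/
theorem exists_algEquiv_smul [Normal K Ω] {β : Ω} {d : ℕ} (hd : (minpoly K β).natDegree = d)
    {γ : K} (hγ : β ^ d = algebraMap K Ω γ) {η : K} (hη : η ^ d = 1) :
    ∃ τ : Ω ≃ₐ[K] Ω, τ β = algebraMap K Ω η * β := by
  have hint : IsIntegral K β := Normal.isIntegral inferInstance β
  have hdpos : 0 < d := hd ▸ minpoly.natDegree_pos hint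
  have hmin : minpoly K β = X ^ d - C γ := by
    refine (eq_of_monic_of_dvd_of_natDegree_le (minpoly.monic hint)
      (monic_X_pow_sub_C γ hdpos.ne') (minpoly.dvd _ _ (by simp [hγ])) ?_).symm
    rw [natDegree_X_pow_sub_C, hd]
  refine (isConjRoot_of_aeval_eq_zero hint ?_).symm.exists_algEquiv
  rw [hmin]
  simp only [map_sub, map_pow, aeval_X, aeval_C, mul_pow, hγ]
  rw [← map_pow, hη, map_one, one_mul, sub_self]

end Kummer

/-! ### Commutativity and descent to `K(β)` -/

section Descent

theorem prod_range_mul_of_periodic {M : Type*} [CommMonoid M] {f : ℕ → M} {e : ℕ}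
    (hf : ∀ j, f (j + e) = f j) (d : ℕ) :
    ∏ j ∈ Finset.range (e * d), f j = (∏ j ∈ Finset.range e, f j) ^ d := by
  induction d with
  | zero => simp
  | succ d ih =>
    have h (j : ℕ) : f (e * d + j) = f j := by
      rw [add_comm, mul_comm]
      exact Function.Periodic.nat_mul (f := f) (c := e) hf d j
    simp only [Nat.mul_succ, Finset.prod_range_add, ih, h, pow_succ]

variable {K Ω : Type*} [Field K] [Field Ω] [Algebra K Ω]

/-- The `q`-th roots `w j` of Galois-conjugate elements `D (ζ ^ j * β)`, on which the Galois group
acts commutatively, have a product some power of which is fixed by the stabilizer of `β`. -/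
theorem prod_pow_fixed_of_comm {N d q : ℕ} [NeZero q] (hdN : d ∣ N) {ζ ω : K}
    (hω : IsPrimitiveRoot ω q) {β : Ω} {D : Ω → Ω} {w : ℕ → Ω}
    (hD : ∀ (σ : Ω ≃ₐ[K] Ω) (r : Ω), σ (D r) = D (σ r))
    (hw : ∀ j, w j ^ q = D (algebraMap K Ω ζ ^ j * β)) (hw0 : ∀ j, w j ≠ 0)
    (hcomm : ∀ (σ τ : Ω ≃ₐ[K] Ω) (j : ℕ), σ (τ (w j)) = τ (σ (w j)))
    {τ : Ω ≃ₐ[K] Ω} (hτ : τ β = algebraMap K Ω (ζ ^ (N / d)) * β)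
    {ρ : Ω ≃ₐ[K] Ω} (hρ : ρ β = β) :
    ρ ((∏ j ∈ Finset.range N, w j) ^ (q / Nat.gcd d q)) =
      (∏ j ∈ Finset.range N, w j) ^ (q / Nat.gcd d q) := by
  set g := Nat.gcd d q
  have hχ (j : ℕ) : ∃ i : ℕ, ρ (w j) = algebraMap K Ω (ω ^ i) * w j := by
    refine exists_smul_of_pow_eq hω (hw0 j) ?_
    rw [← map_pow, hw, hD]
    simp [hρ]
  choose i hi using hχ
  -- Comparing `ρ (τ (w j))` with `τ (ρ (w j))`: the factor `ω ^ l` lies in `K` and cancels.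
  have hper (j : ℕ) : ω ^ i (j + N / d) = ω ^ i j := by
    obtain ⟨l, hl⟩ : ∃ l : ℕ, τ (w j) = algebraMap K Ω (ω ^ l) * w (j + N / d) := by
      refine exists_smul_of_pow_eq hω (hw0 _) ?_
      rw [← map_pow, hw, hw, hD]
      simp [hτ, pow_add, mul_assoc]
    have h := hcomm ρ τ j
    rw [hi, hl, map_mul, map_mul, hi, hl, AlgEquiv.commutes, AlgEquiv.commutes,
      mul_left_comm] at h
    have hne : algebraMap K Ω (ω ^ l) * w (j + N / d) ≠ 0 := by
      rw [← hl]; simpa using hw0 j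
    exact (algebraMap K Ω).injective (mul_right_cancel₀ hne h)
  have hprod : ρ (∏ j ∈ Finset.range N, w j) =
      algebraMap K Ω ((∏ j ∈ Finset.range (N / d), ω ^ i j) ^ d) *
        ∏ j ∈ Finset.range N, w j := by
    rw [← prod_range_mul_of_periodic (f := fun j => ω ^ i j) hper d, Nat.div_mul_cancel hdN,
      map_prod, map_prod, ← Finset.prod_mul_distrib]
    exact Finset.prod_congr rfl fun j _ => hi j
  have hone : ((∏ j ∈ Finset.range (N / d), ω ^ i j) ^ d) ^ (q / g) = 1 := by
    have hdq : d * (q / g) = q * (d / g) := by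
      rw [← Nat.mul_div_assoc _ (Nat.gcd_dvd_right d q), ← Nat.mul_div_assoc _
        (Nat.gcd_dvd_left d q), mul_comm]
    rw [← pow_mul, hdq, pow_mul, ← Finset.prod_pow]
    simp [← pow_mul, mul_comm _ q, pow_mul ω q, hω.pow_eq_one]
  rw [map_pow, hprod, mul_pow, ← map_pow, hone, map_one, one_mul]

/-- Kummer theory: an element `y` of `K(β)` with `y ^ d ∈ K` is a multiple of a power of `β`. -/
theorem exists_eq_mul_pow_of_fixed [IsGalois K Ω] {d : ℕ} [NeZero d] {η : K}
    (hη : IsPrimitiveRoot η d) {β : Ω} (hβ : β ≠ 0) {γ : K} (hγ : β ^ d = algebraMap K Ω γ)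
    {τ : Ω ≃ₐ[K] Ω} (hτ : τ β = algebraMap K Ω η * β) {y : Ω} (hy : y ≠ 0) {c : K}
    (hyc : y ^ d = algebraMap K Ω c) (hfix : ∀ ρ : Ω ≃ₐ[K] Ω, ρ β = β → ρ y = y) :
    ∃ (u : K) (e : ℕ), y = algebraMap K Ω u * β ^ e := by
  have hconj (σ : Ω ≃ₐ[K] Ω) {x : Ω} (hx : x ≠ 0) {t : K} (hxt : x ^ d = algebraMap K Ω t) :
      ∃ i : ℕ, σ x = algebraMap K Ω (η ^ i) * x := by
    refine exists_smul_of_pow_eq hη hx ?_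
    rw [← map_pow, hxt, AlgEquiv.commutes]
  have hη0 : algebraMap K Ω η ≠ 0 := by simpa using hη.ne_zero (NeZero.ne d)
  -- The exponent `e` is chosen so that `τ` scales `y` and `β ^ e` alike. Every automorphism is a
  -- power of `τ` times one fixing `β`, so the quotient is fixed by the whole group.
  obtain ⟨e, he⟩ := hconj τ hy hyc
  have hτz : τ (y / β ^ e) = y / β ^ e := by
    rw [map_div₀, map_pow, hτ, he, mul_pow, map_pow, mul_div_mul_left _ _ (pow_ne_zero _ hη0)]
  have hτpow (x : Ω) (hx : τ x = x) (i : ℕ) : (τ ^ i) x = x :=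
    pow_mem (S := MulAction.stabilizer (Ω ≃ₐ[K] Ω) x) (x := τ) hx i
  have hτβ (i : ℕ) : (τ ^ i) β = algebraMap K Ω (η ^ i) * β := by
    induction i with
    | zero => simp
    | succ i ih =>
      rw [pow_succ', AlgEquiv.mul_apply, ih, map_mul, hτ, AlgEquiv.commutes, pow_succ, map_mul,
        mul_assoc]
  have hz : y / β ^ e ∈ (⊥ : IntermediateField K Ω) := by
    rw [InfiniteGalois.mem_bot_iff_fixed]
    intro σ
    obtain ⟨i, hi⟩ := hconj σ hβ hγ
    have hρ : ((τ ^ i)⁻¹ * σ) β = β := by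
      rw [AlgEquiv.mul_apply, hi, ← hτβ, ← AlgEquiv.mul_apply, inv_mul_cancel, AlgEquiv.one_apply]
    have hρz : ((τ ^ i)⁻¹ * σ) (y / β ^ e) = y / β ^ e := by
      rw [map_div₀, map_pow, hρ, hfix _ hρ]
    have := congrArg (τ ^ i) hρz
    rwa [← AlgEquiv.mul_apply, mul_inv_cancel_left, hτpow _ hτz] at this
  obtain ⟨u, hu⟩ := IntermediateField.mem_bot.mp hz
  exact ⟨u, e, by rw [hu, div_mul_cancel₀ _ (pow_ne_zero _ hβ)]⟩

end Descent

/-! ### Nodes, the arboreal field and the first level -/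

section Arboreal

variable {K : Type*} [Field K]

theorem mem_arborealField {n : ℕ → ℕ} {a b : ℕ → K} (hn : ∀ k, 1 ≤ k → 0 < n k)
    (ha : ∀ k, 1 ≤ k → a k ≠ 0) {α : K} {m : ℕ} {z : SeparableClosure K}
    (hz : aeval z (iter n a b m) = algebraMap K _ α) : z ∈ arborealField n a b α := by
  refine IntermediateField.subset_adjoin _ _ (Set.mem_iUnion.mpr ⟨m, ?_⟩)
  rw [mem_rootSet]
  exact ⟨iter_sub_C_ne_zero hn ha α m, by simp [hz]⟩

theorem normal_arborealField (n : ℕ → ℕ) (a b : ℕ → K) (α : K) :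
    Normal K (arborealField n a b α) := by
  rw [IntermediateField.normal_iff_forall_map_le]
  intro σ
  rw [arborealField, IntermediateField.adjoin_map, Set.image_iUnion]
  refine IntermediateField.adjoin.mono _ _ _ (Set.iUnion_mono fun m => ?_)
  rintro _ ⟨z, hz, rfl⟩
  rw [mem_rootSet] at hz ⊢
  exact ⟨hz.1, by rw [aeval_algHom_apply, hz.2, map_zero]⟩

/-- Normality lets automorphisms of the separable closure restrict to the arboreal field, so the
argument can use the full Galois group although only its quotient is abelian. -/
theorem comm_of_mem_arborealField {n : ℕ → ℕ} {a b : ℕ → K} {α : K}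
    (hab : ∀ σ τ : arborealGroup n a b α, σ * τ = τ * σ)
    (σ τ : SeparableClosure K ≃ₐ[K] SeparableClosure K) {x : SeparableClosure K}
    (hx : x ∈ arborealField n a b α) : σ (τ x) = τ (σ x) := by
  have := normal_arborealField n a b α
  have h := congrArg (fun φ => ((φ ⟨x, hx⟩ : arborealField n a b α) : SeparableClosure K))
    (hab (σ.restrictNormal _) (τ.restrictNormal _))
  simpa [AlgEquiv.restrictNormal_apply] using h

/-- A single root of `f_1 - α` generates the extension generated by all the roots. -/
theorem firstField_eq_adjoin {n : ℕ → ℕ} {a b : ℕ → K} {α : K} [NeZero (n 1)] (ha : a 1 ≠ 0)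
    {ζ : K} (hζ : IsPrimitiveRoot ζ (n 1)) {β : SeparableClosure K} (hβ : β ≠ 0)
    (hβc : β ^ n 1 = algebraMap K _ (cTilde n a b α 1)) :
    firstField n a b α = IntermediateField.adjoin K {β} := by
  have ha' : algebraMap K (SeparableClosure K) (a 1) ≠ 0 := by simpa using ha
  have hiff (z : SeparableClosure K) :
      aeval z (poly n a b 1 - C α) = 0 ↔ z ^ n 1 = β ^ n 1 := by
    rw [hβc, cTilde_one_eq a b α (NeZero.ne _), map_div₀, eq_div_iff ha']
    simp only [poly, map_sub, map_add, map_mul, aeval_C, map_pow, aeval_X]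
    constructor <;> intro h <;> linear_combination h
  have hne : poly n a b 1 - C α ≠ 0 := by
    intro h
    have h1 := natDegree_poly (n := n) (b := b) ha
    rw [sub_eq_zero.mp h, natDegree_C] at h1
    exact NeZero.ne _ h1.symm
  refine le_antisymm (IntermediateField.adjoin_le_iff.mpr fun z hz => ?_)
    (IntermediateField.adjoin_simple_le_iff.mpr
      (IntermediateField.subset_adjoin _ _ (mem_rootSet.mpr ⟨hne, (hiff β).mpr rfl⟩)))
  obtain ⟨i, rfl⟩ := exists_smul_of_pow_eq hζ hβ ((hiff z).mp (mem_rootSet.mp hz).2)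
  exact mul_mem (IntermediateField.algebraMap_mem _ _)
    (IntermediateField.mem_adjoin_simple_self K β)

theorem finrank_firstField {n : ℕ → ℕ} {a b : ℕ → K} {α : K} [NeZero (n 1)] (ha : a 1 ≠ 0)
    {ζ : K} (hζ : IsPrimitiveRoot ζ (n 1)) {β : SeparableClosure K} (hβ : β ≠ 0)
    (hβc : β ^ n 1 = algebraMap K _ (cTilde n a b α 1)) :
    Module.finrank K (firstField n a b α) = (minpoly K β).natDegree := by
  rw [firstField_eq_adjoin ha hζ hβ hβc]
  exact IntermediateField.adjoin.finrank (Algebra.IsIntegral.isIntegral β)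

/-- The `n_k`-th roots of the factors of `c̃_k` over the roots of `f_1 - α`. -/
theorem exists_roots_of_factors {n : ℕ → ℕ} {a b : ℕ → K} {α : K} (hn : ∀ k, 1 ≤ k → 0 < n k)
    (hζ : ∀ k, 1 ≤ k → ∃ ζ : K, IsPrimitiveRoot ζ (n k)) (ha : ∀ k, 1 ≤ k → a k ≠ 0)
    {ζ : K} (hζ1 : IsPrimitiveRoot ζ (n 1)) {β : SeparableClosure K}
    (hβc : β ^ n 1 = algebraMap K _ (cTilde n a b α 1)) (m : ℕ) :
    ∃ (D : SeparableClosure K → SeparableClosure K) (w : ℕ → SeparableClosure K),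
      (∀ (σ : SeparableClosure K ≃ₐ[K] SeparableClosure K) r, σ (D r) = D (σ r)) ∧
      (∀ j, w j ∈ arborealField n a b α) ∧
      (∀ j, w j ^ n (m + 2) = D (algebraMap K _ ζ ^ j * β)) ∧
      ∏ j ∈ Finset.range (n 1), D (algebraMap K _ ζ ^ j * β) =
        algebraMap K _ (cTilde n a b α (m + 2)) := by
  set ι := algebraMap K (SeparableClosure K) with hι
  have ha1 := ha 1 le_rfl
  have hα : ι (a 1) * β ^ n 1 + ι (b 1) = ι α := by
    rw [hβc, cTilde_one_eq a b α (hn 1 le_rfl).ne', ← map_mul, ← map_add]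
    congr 1
    field_simp
    ring
  have hζι (k : ℕ) (hk : 1 ≤ k) : ∃ ω : SeparableClosure K, IsPrimitiveRoot ω (n k) :=
    (hζ k hk).imp' ι fun _ h => h.map_of_injective ι.injective
  have hζ1' := hζ1.map_of_injective ι.injective
  -- The coefficients come from `K`, so `D` commutes with the Galois action.
  let D (r : SeparableClosure K) := cTilde (fun i => n (i + 1)) (fun i => ι (a (i + 1)))
    (fun i => ι (b (i + 1))) r (m + 1)
  have hroot (j : ℕ) : ∃ w ∈ arborealField n a b α, w ^ n (m + 2) = D (ι ζ ^ j * β) := by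
    refine exists_pow_eq_cTilde m (fun i => n (i + 1)) _ _ _ (fun k _ => hn _ (by omega))
      (fun k _ => hζι _ (by omega)) (fun k _ => by simpa using ha (k + 1) (by omega))
      (arborealField n a b α).toSubalgebra.toSubmonoid fun z hz => ?_
    refine mem_arborealField (m := m + 2) hn ha ?_
    rw [← eval_map_algebraMap, iter_map, iter_eval_succ, hz, mul_pow, ← pow_mul, mul_comm j,
      pow_mul, hζ1'.pow_eq_one, one_pow, one_mul]
    exact hα
  choose w hwmem hw using hroot
  refine ⟨D, w, fun σ r => ?_, hwmem, hw, ?_⟩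
  · have := map_cTilde (σ : SeparableClosure K →+* SeparableClosure K) (fun i => n (i + 1))
      (fun i => ι (a (i + 1))) (fun i => ι (b (i + 1))) r (m + 1)
    simpa [ι] using this
  · rw [map_cTilde, ← hα]
    exact (cTilde_succ_eq_prod (fun i => ι (a i)) (fun i => ι (b i)) (hn 1 le_rfl)
      (by simpa using ha1) hζ1' m).symm

end Arboreal

end ArborealSeq

/-! ### Proof of the main theorem -/

open ArborealSeq

theorem mainTheorem6 {K : Type*} [Field K] (n : ℕ → ℕ) (hn : ∀ k, 1 ≤ k → 2 ≤ n k)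
    (hζ : ∀ k, 1 ≤ k → ∃ ζ : K, IsPrimitiveRoot ζ (n k))
    (a b : ℕ → K) (ha : ∀ k, 1 ≤ k → a k ≠ 0) (α : K)
    (hc : ∀ m, 1 ≤ m → ArborealSeq.adjOrbit n a b α m ≠ 0)
    (d₁ : ℕ) (hd₁ : d₁ = Module.finrank K (ArborealSeq.firstField n a b α))
    (hab : ∀ σ τ : ArborealSeq.arborealGroup n a b α, σ * τ = τ * σ) :
    d₁ ∣ n 1 ∧
    (∃ γ₁ : Kˣ, γ₁ ^ (n 1 / d₁) = ArborealSeq.cTildeUnit ha hc 1 le_rfl) ∧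
    ∀ γ₁ : Kˣ, γ₁ ^ (n 1 / d₁) = ArborealSeq.cTildeUnit ha hc 1 le_rfl →
      Subgroup.closure {x : Kˣ ⧸ ArborealSeq.powSubgroup K d₁ |
          ∃ (k : ℕ) (hk : 2 ≤ k),
            x = QuotientGroup.mk
              (ArborealSeq.cTildeUnit ha hc k (one_le_two.trans hk) ^ (d₁ / Nat.gcd d₁ (n k)))} ≤
        Subgroup.zpowers (QuotientGroup.mk γ₁ : Kˣ ⧸ ArborealSeq.powSubgroup K d₁) := by
  have hn0 (k : ℕ) (hk : 1 ≤ k) : 0 < n k := by have := hn k hk; omega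
  have hN : NeZero (n 1) := ⟨(hn0 1 le_rfl).ne'⟩
  obtain ⟨ζ, hζ1⟩ := hζ 1 le_rfl
  have hc1 := cTilde_ne_zero ha hc 1 le_rfl
  have ha1 := ha 1 le_rfl
  have hbase {β : SeparableClosure K}
      (hβc : β ^ n 1 = algebraMap K _ (cTilde n a b α 1)) :
      β ≠ 0 ∧ (minpoly K β).natDegree = d₁ ∧ d₁ ∣ n 1 ∧ ∃ γ : K, β ^ d₁ = algebraMap K _ γ := by
    have hβ : β ≠ 0 := by
      rintro rfl
      rw [zero_pow (NeZero.ne _), eq_comm, map_eq_zero] at hβc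
      exact hc1 hβc
    have hfin := hd₁.trans (finrank_firstField ha1 hζ1 hβ hβc)
    have := exists_pow_natDegree_minpoly_eq hζ1 hβ hβc
    rw [← hfin] at this
    exact ⟨hβ, hfin.symm, this⟩
  have hNK : NeZero (n 1 : K) := hζ1.neZero'
  have hne {k : ℕ} (hk : k ∣ n 1) : NeZero (k : SeparableClosure K) := by
    refine ⟨fun h => hNK.out ((algebraMap K (SeparableClosure K)).injective ?_)⟩
    obtain ⟨t, ht⟩ := hk
    simp [ht, h]
  obtain ⟨hdvd, hex⟩ : d₁ ∣ n 1 ∧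
      ∃ γ₁ : Kˣ, γ₁ ^ (n 1 / d₁) = ArborealSeq.cTildeUnit ha hc 1 le_rfl := by
    have := hne dvd_rfl
    obtain ⟨β, hβc⟩ := IsSepClosed.exists_pow_nat_eq
      (algebraMap K (SeparableClosure K) (cTilde n a b α 1)) (n 1)
    obtain ⟨hβ, -, hdvd, γ, hγ⟩ := hbase hβc
    have hγ0 : γ ≠ 0 := by
      rintro rfl
      rw [map_zero] at hγ
      exact pow_ne_zero _ hβ hγ
    refine ⟨hdvd, Units.mk0 γ hγ0, Units.ext ((algebraMap K (SeparableClosure K)).injective ?_)⟩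
    simp only [Units.val_pow_eq_pow_val, Units.val_mk0, cTildeUnit]
    rw [map_pow, ← hγ, ← pow_mul, Nat.mul_div_cancel' hdvd, hβc]
  refine ⟨hdvd, hex, fun γ₁ hγ₁ => (Subgroup.closure_le _).mpr ?_⟩
  rintro _ ⟨k, hk, rfl⟩
  have := hne hdvd
  -- Since `γ₁` is prescribed, `β` is chosen as a `d₁`-th root of it; it is then also an `n 1`-th
  -- root of `c̃_1`.
  obtain ⟨β, hβγ⟩ := IsSepClosed.exists_pow_nat_eq (algebraMap K (SeparableClosure K) γ₁) d₁
  have hγ₁' : (γ₁ : K) ^ (n 1 / d₁) = cTilde n a b α 1 := by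
    simpa [cTildeUnit] using congrArg Units.val hγ₁
  have hβc : β ^ n 1 = algebraMap K _ (cTilde n a b α 1) := by
    rw [← hγ₁', map_pow, ← hβγ, ← pow_mul, Nat.mul_div_cancel' hdvd]
  obtain ⟨hβ, hdeg, -⟩ := hbase hβc
  obtain ⟨m, rfl⟩ := Nat.exists_eq_add_of_le' hk
  obtain ⟨D, w, hD, hwmem, hw, hprod⟩ := exists_roots_of_factors hn0 hζ ha hζ1 hβc m
  have hck := cTilde_ne_zero ha hc (m + 2) (by omega)
  have hq : NeZero (n (m + 2)) := ⟨(hn0 _ (by omega)).ne'⟩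
  have hd0 : NeZero d₁ := ⟨fun h => NeZero.ne (n 1) (Nat.eq_zero_of_zero_dvd (h ▸ hdvd))⟩
  have hζ1' := hζ1.map_of_injective (algebraMap K (SeparableClosure K)).injective
  -- The product formula only covers `j < n 1`; other indices are reduced modulo `n 1`, the order of
  -- `ζ`.
  have hw0 (j : ℕ) : w j ≠ 0 := by
    intro h
    have hj := hw j
    rw [h, zero_pow (NeZero.ne _), ← Nat.mod_add_div j (n 1), pow_add, pow_mul, hζ1'.pow_eq_one,
      one_pow, mul_one] at hj
    rw [Finset.prod_eq_zero (Finset.mem_range.mpr (Nat.mod_lt j (hn0 1 le_rfl))) hj.symm, eq_comm,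
      map_eq_zero] at hprod
    exact hck hprod
  obtain ⟨ω, hω⟩ := hζ (m + 2) (by omega)
  have hη : IsPrimitiveRoot (ζ ^ (n 1 / d₁)) d₁ :=
    hζ1.pow (hn0 1 le_rfl) (Nat.div_mul_cancel hdvd).symm
  obtain ⟨τ, hτ⟩ := exists_algEquiv_smul hdeg hβγ hη.pow_eq_one
  have hfix (ρ : SeparableClosure K ≃ₐ[K] SeparableClosure K) (hρ : ρ β = β) :=
    prod_pow_fixed_of_comm hdvd hω hD hw hw0
      (fun σ τ j => comm_of_mem_arborealField hab σ τ (hwmem j)) hτ hρ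
  have hyc : ((∏ j ∈ Finset.range (n 1), w j) ^ (n (m + 2) / Nat.gcd d₁ (n (m + 2)))) ^ d₁ =
      algebraMap K _ (cTilde n a b α (m + 2) ^ (d₁ / Nat.gcd d₁ (n (m + 2)))) := by
    rw [map_pow, ← hprod, ← Finset.prod_congr rfl fun j _ => hw j, Finset.prod_pow, ← pow_mul,
      ← pow_mul, ← Nat.mul_div_assoc _ (Nat.gcd_dvd_left _ _), Nat.div_mul_right_comm
      (Nat.gcd_dvd_right _ _)]
  obtain ⟨u, e, hu⟩ := exists_eq_mul_pow_of_fixed hη hβ hβγ hτ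
    (pow_ne_zero _ (Finset.prod_ne_zero_iff.mpr fun j _ => hw0 j)) hyc hfix
  have heq : cTilde n a b α (m + 2) ^ (d₁ / Nat.gcd d₁ (n (m + 2))) = γ₁ ^ e * u ^ d₁ := by
    refine (algebraMap K (SeparableClosure K)).injective ?_
    rw [← hyc, hu, mul_pow, ← pow_mul, mul_comm e, pow_mul, hβγ, map_mul, map_pow, map_pow,
      mul_comm]
  have hu0 : u ≠ 0 := by
    rintro rfl
    rw [zero_pow (NeZero.ne _), mul_zero] at heq
    exact pow_ne_zero _ hck heq
  refine Subgroup.mem_zpowers_iff.mpr ⟨e, ?_⟩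
  rw [zpow_natCast, ← QuotientGroup.mk_pow, QuotientGroup.eq]
  refine ⟨Units.mk0 u hu0, ?_⟩
  rw [powMonoidHom_apply, eq_inv_mul_iff_mul_eq]
  exact Units.ext heq.symm
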